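/- Let $K$ be a slim, planar, semimodular lattice with at least three elements; that is, $K$ is a finite lattice with $|K|\ge 3$ such that * $K$ is semimodular: $x\wedge y\prec x$ implies $y\prec x\vee y$; * $K$ is planar: it has a Hasse diagram in the plane (distinct elements at distinct points, each covering pair $x\prec y$ drawn as a straight line segment with $y$ higher than $x$) in which edges pass through no element other than their endpoints and meet each other only at elements; * $K$ is slim: it has no sublattice isomorphic to $M_3$, the five-element lattice with three pairwise incomparable middle elements. Let $\mathcal P$ be the ordered set of join-irreducible congruences of $K$ (the join-irreducible elements of the congruence lattice of $K$, ordered by inclusion). Let $\mathcal R$ be the ten-element ordered set $\{a,b,c,d,p,q,r,s,u,v\}$ (the four-crown with two pendants) whose covering pairs are exactly $$p\prec a,\; p\prec b,\; q\prec b,\; q\prec c,\; r\prec c,\; r\prec d,\; s\prec d,\; s\prec a,\qquad u\prec p,\; u\prec r,\qquad v\prec q,\; v\prec s .$$ Its maximal elements are $a,b,c,d$. **Theorem (Four-crown Two-pendant Property).** There is no map $f\colon\mathcal R\to\mathcal P$ that is a cover-preserving embedding ($f(x)\le f(y)$ if and only if $x\le y$, and $x\prec y$ implies $f(x)\prec f(y)$)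 and that maps every maximal element of $\mathcal R$ to a maximal element of $\mathcal P$. -/

import Mathlib

/-! ### The congruence lattice of a lattice -/

namespace LatticeCon

variable {α : Type*} [Lattice α]

theorem toSetoid_injective :
    Function.Injective (LatticeCon.toSetoid : LatticeCon α → Setoid α) := by
  rintro ⟨r, _, _⟩ ⟨s, _, _⟩ h
  cases h
  rfl

/-- Congruences are ordered by inclusion of relations: `c ≤ d` if and only if
`c.r x y` implies `d.r x y` for all `x`, `y`. -/
instance instPartialOrder : PartialOrder (LatticeCon α) :=
  PartialOrder.lift LatticeCon.toSetoid toSetoid_injective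

theorem le_iff {c d : LatticeCon α} : c ≤ d ↔ ∀ x y, c.r x y → d.r x y :=
  ⟨fun h _ _ hxy => h hxy, fun h _ _ hxy => h _ _ hxy⟩

/-- The infimum of a set of congruences is their intersection. -/
instance instInfSet : InfSet (LatticeCon α) where
  sInf S :=
    { r := fun x y => ∀ c ∈ S, c.r x y
      iseqv :=
        ⟨fun x c _ => c.refl x, fun h c hc => c.symm (h c hc),
          fun h₁ h₂ c hc => c.trans (h₁ c hc) (h₂ c hc)⟩
      inf := fun h₁ h₂ c hc => c.inf (h₁ c hc) (h₂ c hc)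
      sup := fun h₁ h₂ c hc => c.sup (h₁ c hc) (h₂ c hc) }

/-- The congruence lattice `Con L`. -/
instance instCompleteLattice : CompleteLattice (LatticeCon α) :=
  completeLatticeOfInf (LatticeCon α) fun _ =>
    ⟨fun c hc => le_iff.2 fun _ _ h => h c hc,
      fun _ hd => le_iff.2 fun x y hxy _ hc => le_iff.1 (hd hc) x y hxy⟩

end LatticeCon

/-- The ordered set `Ji (Con L)` of join-irreducible congruences of a lattice `L`, with the order
inherited from `Con L`. (A join-irreducible element is nonzero.) -/
abbrev JiCon (L : Type*) [Lattice L] : Type _ :=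
  {c : LatticeCon L // SupIrred c}

/-! ### Slim, planar, semimodular lattices -/

/-- A planar diagram of an ordered set: elements are placed at distinct points of the plane; each
covering pair `a ⋖ b` is drawn as the straight line segment from `a` to `b`, with `b` placed
higher than `a`; and these segments pass through no element besides their endpoints and meet
each other only at elements. -/
structure PlanarDiagram (α : Type*) [PartialOrder α] where
  pos : α → ℝ × ℝ
  injective : Function.Injective pos
  lt_of_covBy : ∀ a b, a ⋖ b → (pos a).2 < (pos b).2
  eq_of_mem_segment : ∀ a b c, a ⋖ b → pos c ∈ segment ℝ (pos a) (pos b) → c = a ∨ c = b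
  inter_subset : ∀ a b c d, a ⋖ b → c ⋖ d → (a, b) ≠ (c, d) →
    segment ℝ (pos a) (pos b) ∩ segment ℝ (pos c) (pos d) ⊆ Set.range pos

/-- An ordered set is planar if it has a planar diagram. -/
def IsPlanar (α : Type*) [PartialOrder α] : Prop :=
  Nonempty (PlanarDiagram α)

/-- `L` has a sublattice isomorphic to `M₃`: three distinct elements `x`, `y`, `z`, any two
of which have the same meet `o` and the same join `i`; the sublattice is `{o, x, y, z, i}`. -/
def HasM3Sublattice (L : Type*) [Lattice L] : Prop :=
  ∃ o x y z i : L, x ≠ y ∧ y ≠ z ∧ x ≠ z ∧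
    x ⊓ y = o ∧ y ⊓ z = o ∧ x ⊓ z = o ∧
    x ⊔ y = i ∧ y ⊔ z = i ∧ x ⊔ z = i

/-- SPS lattices: slim (without `M₃` sublattices), finite, planar, (upper) semimodular lattices. -/
structure IsSPSLattice (L : Type*) [Lattice L] : Prop where
  finite : Finite L
  planar : IsPlanar L
  semimodular : IsUpperModularLattice L
  slim : ¬ HasM3Sublattice L

/-! ### The four-crown with two pendants -/

/-- The ten elements of the four-crown with two pendants `R`. -/
inductive CrownR : Type
  | a | b | c | d | p | q | r | s | u | v
  deriving DecidableEq

namespace CrownR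

instance instFintype : Fintype CrownR where
  elems := {a, b, c, d, p, q, r, s, u, v}
  complete x := by cases x <;> decide

/-- The covering pairs of `R`. The maximal elements `a, b, c, d` and the elements `p, q, r, s`
form the four-crown `a, p, b, q, c, r, d, s`; the pendant `u` is covered by the
opposite elements `p, r`, and the pendant `v` by the opposite elements `q, s`. -/
def cov : CrownR → CrownR → Bool
  | p, a => true
  | p, b => true
  | q, b => true
  | q, c => true
  | r, c => true
  | r, d => true
  | s, d => true
  | s, a => true
  | u, p => true
  | u, r => true
  | v, q => true
  | v, s => true
  | _, _ => false

/-- The order of `R`, the reflexive transitive closure of `cov` (all chains have length at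
most two). -/
instance instLE : LE CrownR where
  le x y := x = y ∨ cov x y = true ∨ ∃ z, cov x z = true ∧ cov z y = true

instance instDecidableLE : DecidableLE CrownR := fun x y =>
  inferInstanceAs (Decidable (x = y ∨ cov x y = true ∨ ∃ z, cov x z = true ∧ cov z y = true))

instance instPartialOrder : PartialOrder CrownR where
  le_refl x := Or.inl rfl
  le_trans := by decide
  le_antisymm := by decide

theorem covBy_iff (x y : CrownR) : x ⋖ y ↔ cov x y = true := by
  have h : x ⋖ y ↔ (x ≤ y ∧ ¬ y ≤ x) ∧ ∀ z : CrownR, (x ≤ z ∧ ¬ z ≤ x) → ¬ (z ≤ y ∧ ¬ y ≤ z) := by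
    simp only [CovBy, lt_iff_le_not_ge]
  rw [h]
  clear h
  revert x y
  decide

theorem isMax_iff (x : CrownR) : IsMax x ↔ x = a ∨ x = b ∨ x = c ∨ x = d := by
  unfold IsMax
  revert x
  decide

end CrownR

/-- A cover-preserving embedding of ordered sets: an order embedding that maps every covering pair
to a covering pair. -/
structure IsCoverPreservingEmbedding {α β : Type*} [PartialOrder α] [PartialOrder β]
    (f : α → β) : Prop where
  le_iff_le : ∀ x y, f x ≤ f y ↔ x ≤ y
  covBy : ∀ x y, x ⋖ y → f x ⋖ f y

/-!
The congruences of a slim, planar, semimodular lattice `L` are described by finitely many points in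
the plane, and the theorem becomes a statement about the relative position of these points.

In a planar diagram, consider the cell formed by an element `x`, two of its covers `y`, `z` and
`w = y ⊔ z`. An upward path that starts inside the cell can leave it only at `y`, `z` or `w`
(`PlanarDiagram.inside_or_eq`, `PlanarDiagram.le_of_inside`), so its elements in the cell are below
`w`. Hence an element has no cover between its leftmost and its rightmost one (together with them
it would generate an `M₃`), and the top of a cell is the rightmost cover of the left corner and
the leftmost cover of the right corner (`PlanarDiagram.nonempty_coverFrame`). It follows that every
element is the join of an element of the left boundary chain and one of the right boundary chain
(`CoverFrame.exists_eq_sup`). The steps of the left chain serve as labels, and `x` has a label if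
joining with `x` collapses the corresponding step. The two boundary chains acquire the labels in
two linear orders, and `L` is isomorphic to the set of all unions of an initial segment of the first
order and one of the second (`CoverFrame.nonempty_coding`).

A label becomes a point whose coordinates are its positions in the two orders. A point `e` which has
a higher point on its left and a lower point on its right has two parents: the nearest higher point
on the left and, with the roles of the coordinates exchanged, the nearest lower point on the right.
The other points are the left-to-right maxima and the right-to-left minima, and have no parents. A
congruence is determined by the set of labels it collapses, and the sets which occur are those
containing every point that has a parent in the set (`TwoOrderCoding.Collapses.of_parent`,
`TwoOrderCoding.ofSet`). So the join-irreducible congruences are the classes of the preorder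
generated by the parents (`TwoOrderCoding.con_le_con_iff`, `TwoOrderCoding.exists_con_eq`).

The crown is excluded by one observation (`Parent.lt_of_lt`): the points below and to the left of a
given point `z` are closed under taking descendants. The maximal classes are points without
parents. Maximal classes with a common lower cover are of different types, so in the crown `a`, `c`
are left-to-right maxima and `b`, `d` right-to-left minima, or conversely. Left-to-right maxima
increase from left to right, and so do right-to-left minima. If `c` is above `a` and `d` is above
`b`, then `p`, covered by `a` and `b`, and everything below `p` are below and to the left of both
`c` and `d`, whereas no point of `r` is, nor can a point that is have a parent in `r`
(`false_of_corner`). So the pendant `u` cannot exist. The other three arrangements of the pairs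
`a`, `c` and `b`, `d` are treated in the same way, with `v` in place of `u` for two of them.
-/

/-! ### Planar diagrams: leaving a cell -/

namespace PlanarDiagram

/-- The reciprocal slope of the line through `a` and `b`: horizontal displacement per unit of
height. Of two edges leaving a point upwards, the one with smaller `tilt` is on the left. -/
noncomputable def tilt (a b : ℝ × ℝ) : ℝ := (b.1 - a.1) / (b.2 - a.2)

/-- The horizontal coordinate at height `h` on the line through `a` and `b`. -/
noncomputable def lineAt (a b : ℝ × ℝ) (h : ℝ) : ℝ := a.1 + (h - a.2) * tilt a b

/-- The horizontal coordinate at height `h` on the path which follows the line through `a` and `b`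
up to the height of `b` and the line through `b` and `c` from there on. -/
noncomputable def bend (a b c : ℝ × ℝ) (h : ℝ) : ℝ :=
  if h ≤ b.2 then lineAt a b h else lineAt b c h

theorem lineAt_left (a b : ℝ × ℝ) : lineAt a b a.2 = a.1 := by simp [lineAt]

theorem lineAt_right {a b : ℝ × ℝ} (hab : a.2 < b.2) : lineAt a b b.2 = b.1 := by
  have : b.2 - a.2 ≠ 0 := by linarith
  simp only [lineAt, tilt]
  field_simp
  ring

theorem lineAt_lt_lineAt {a b c : ℝ × ℝ} {h : ℝ} (hh : a.2 < h) (hs : tilt a b < tilt a c) :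
    lineAt a b h < lineAt a c h := by
  have := mul_lt_mul_of_pos_left hs (sub_pos.2 hh)
  simp only [lineAt]
  linarith

theorem continuous_lineAt (a b : ℝ × ℝ) : Continuous (lineAt a b) := by
  unfold lineAt
  fun_prop

theorem bend_of_le {a b c : ℝ × ℝ} {h : ℝ} (hh : h ≤ b.2) : bend a b c h = lineAt a b h :=
  if_pos hh

theorem bend_of_ge {a b c : ℝ × ℝ} (hab : a.2 < b.2) {h : ℝ} (hh : b.2 ≤ h) :
    bend a b c h = lineAt b c h := by
  rcases hh.eq_or_lt with rfl | hh
  · rw [bend_of_le le_rfl, lineAt_right hab, lineAt_left]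
  · exact if_neg hh.not_ge

theorem continuous_bend {a b c : ℝ × ℝ} (hab : a.2 < b.2) : Continuous (bend a b c) := by
  refine Continuous.if_le (continuous_lineAt a b) (continuous_lineAt b c) continuous_id
    continuous_const ?_
  rintro h rfl
  rw [lineAt_right hab, lineAt_left]

theorem mem_segment_lineAt {a b : ℝ × ℝ} (hab : a.2 < b.2) {h : ℝ} (h₁ : a.2 ≤ h)
    (h₂ : h ≤ b.2) : (lineAt a b h, h) ∈ segment ℝ a b := by
  have hpos : 0 < b.2 - a.2 := sub_pos.2 hab
  rw [segment_eq_image']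
  refine ⟨(h - a.2) / (b.2 - a.2), ⟨by apply div_nonneg <;> linarith, ?_⟩, ?_⟩
  · rw [div_le_one hpos]
    linarith
  · ext
    · simp only [lineAt, tilt, Prod.fst_add, Prod.smul_fst, Prod.fst_sub, smul_eq_mul]
      field_simp
    · simp only [Prod.snd_add, Prod.smul_snd, Prod.snd_sub, smul_eq_mul]
      field_simp
      ring

/-- The reflection of the plane in the vertical axis. -/
def reflection : ℝ × ℝ →ₗ[ℝ] ℝ × ℝ := (-LinearMap.id).prodMap LinearMap.id

theorem reflection_injective : Function.Injective reflection := by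
  rintro ⟨a, b⟩ ⟨c, d⟩ h
  simpa [reflection] using h

theorem segment_reflection (a b : ℝ × ℝ) :
    segment ℝ (reflection a) (reflection b) = reflection '' segment ℝ a b :=
  (image_segment ℝ reflection.toAffineMap a b).symm

variable {α : Type*} [PartialOrder α] (D : PlanarDiagram α)

/-- Two edges that meet at a point which is not the lower end of the second one
share the upper end of the second one. -/
theorem eq_of_mem_segments {a b s t : α} (hab : a ⋖ b) (hst : s ⋖ t) {q : ℝ × ℝ}
    (h₁ : q ∈ segment ℝ (D.pos a) (D.pos b)) (h₂ : q ∈ segment ℝ (D.pos s) (D.pos t))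
    (hq : (D.pos s).2 < q.2) : t = a ∨ t = b := by
  by_cases he : (a, b) = (s, t)
  · exact Or.inr (Prod.ext_iff.1 he).2.symm
  · obtain ⟨c, rfl⟩ := D.inter_subset a b s t hab hst he ⟨h₁, h₂⟩
    rcases D.eq_of_mem_segment s t c hst h₂ with rfl | rfl
    · exact absurd hq (lt_irrefl _)
    · exact D.eq_of_mem_segment a b c hab h₁

/-- An edge that changes sides of the two-edge path through `x`, `y`, `w` ends at `y` or `w`. -/
theorem eq_of_crosses {x y w s t : α} (hxy : x ⋖ y) (hyw : y ⋖ w) (hst : s ⋖ t) {h₀ h₁ : ℝ}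
    (hs : (D.pos s).2 ≤ h₀) (h₀₁ : h₀ ≤ h₁) (ht : h₁ ≤ (D.pos t).2) (hx : (D.pos x).2 ≤ h₀)
    (hw : h₁ ≤ (D.pos w).2)
    (hF : (bend (D.pos x) (D.pos y) (D.pos w) h₀ < lineAt (D.pos s) (D.pos t) h₀ ∧
        lineAt (D.pos s) (D.pos t) h₁ ≤ bend (D.pos x) (D.pos y) (D.pos w) h₁) ∨
      (lineAt (D.pos s) (D.pos t) h₀ < bend (D.pos x) (D.pos y) (D.pos w) h₀ ∧
        bend (D.pos x) (D.pos y) (D.pos w) h₁ ≤ lineAt (D.pos s) (D.pos t) h₁)) :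
    t = y ∨ t = w := by
  have hx2 := D.lt_of_covBy _ _ hxy
  have hy2 := D.lt_of_covBy _ _ hyw
  have hs2 := D.lt_of_covBy _ _ hst
  -- Both paths are graphs of continuous functions of the height.
  have hcont : ContinuousOn (fun h => lineAt (D.pos s) (D.pos t) h -
      bend (D.pos x) (D.pos y) (D.pos w) h) (Set.Icc h₀ h₁) :=
    ((continuous_lineAt _ _).sub (continuous_bend hx2)).continuousOn
  obtain ⟨h, hh, hzero⟩ : ∃ h ∈ Set.Icc h₀ h₁, lineAt (D.pos s) (D.pos t) h -
      bend (D.pos x) (D.pos y) (D.pos w) h = 0 := by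
    rcases hF with ⟨hF₀, hF₁⟩ | ⟨hF₀, hF₁⟩
    · exact intermediate_value_Icc' h₀₁ hcont ⟨by linarith, by linarith⟩
    · exact intermediate_value_Icc h₀₁ hcont ⟨by linarith, by linarith⟩
  have hne : h₀ < h := by
    refine lt_of_le_of_ne hh.1 ?_
    rintro rfl
    rcases hF with ⟨hF₀, -⟩ | ⟨hF₀, -⟩ <;> linarith
  have hmem := mem_segment_lineAt hs2 (hs.trans hne.le) (hh.2.trans ht)
  have htx : t ≠ x := by
    rintro rfl
    linarith [hh.2]
  rcases le_total h (D.pos y).2 with hy | hy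
  · rw [bend_of_le hy] at hzero
    have hmem' := mem_segment_lineAt hx2 (hx.trans hne.le) hy
    rw [← sub_eq_zero.1 hzero] at hmem'
    exact (D.eq_of_mem_segments hxy hst hmem' hmem (hs.trans_lt hne)).elim
      (fun h => absurd h htx) Or.inl
  · rw [bend_of_ge hx2 hy] at hzero
    have hmem' := mem_segment_lineAt hy2 hy (hh.2.trans hw)
    rw [← sub_eq_zero.1 hzero] at hmem'
    exact D.eq_of_mem_segments hyw hst hmem' hmem (hs.trans_lt hne)

/-- Different edges leaving the same element upwards have different directions. -/
theorem tilt_ne {x y z : α} (hxy : x ⋖ y) (hxz : x ⋖ z) (hne : y ≠ z) :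
    tilt (D.pos x) (D.pos y) ≠ tilt (D.pos x) (D.pos z) := by
  have key : ∀ y z : α, x ⋖ y → x ⋖ z → y ≠ z → (D.pos y).2 ≤ (D.pos z).2 →
      tilt (D.pos x) (D.pos y) ≠ tilt (D.pos x) (D.pos z) := by
    intro y z hxy hxz hne hle heq
    have hy := D.lt_of_covBy _ _ hxy
    have h := mem_segment_lineAt (D.lt_of_covBy _ _ hxz) hy.le hle
    have h' := lineAt_right hy
    simp only [lineAt, heq] at h h'
    rw [h'] at h
    rcases D.eq_of_mem_segment x z y hxz h with h | h
    · exact hxy.lt.ne' h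
    · exact hne h
  rcases le_total (D.pos y).2 (D.pos z).2 with hle | hle
  · exact key y z hxy hxz hne hle
  · exact (key z y hxz hxy hne.symm hle).symm

/-- The reflection of a planar diagram in a vertical line. -/
def mirror : PlanarDiagram α where
  pos a := reflection (D.pos a)
  injective := reflection_injective.comp D.injective
  lt_of_covBy := D.lt_of_covBy
  eq_of_mem_segment a b c hab hc := by
    rw [segment_reflection, reflection_injective.mem_set_image] at hc
    exact D.eq_of_mem_segment a b c hab hc
  inter_subset a b c d hab hcd hne := by
    rw [segment_reflection, segment_reflection, ← Set.image_inter reflection_injective]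
    rintro _ ⟨q, hq, rfl⟩
    obtain ⟨e, rfl⟩ := D.inter_subset a b c d hab hcd hne hq
    exact ⟨e, rfl⟩

theorem tilt_mirror (a b : α) :
    tilt (D.mirror.pos a) (D.mirror.pos b) = -tilt (D.pos a) (D.pos b) := by
  simp only [mirror, reflection, tilt, LinearMap.prodMap_apply, LinearMap.neg_apply,
    LinearMap.id_apply]
  ring

/-- The position of `v` is in the interior of the cell with bottom `x`, left corner `y`, right
corner `z` and top `w`. -/
def Inside (x y z w v : α) : Prop :=
  (D.pos x).2 < (D.pos v).2 ∧ (D.pos v).2 < (D.pos w).2 ∧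
    bend (D.pos x) (D.pos y) (D.pos w) (D.pos v).2 < (D.pos v).1 ∧
    (D.pos v).1 < bend (D.pos x) (D.pos z) (D.pos w) (D.pos v).2

/-- An edge one of whose points is in the interior of a cell either ends in the interior or
leaves the cell through a corner other than the bottom. -/
theorem inside_or_eq {x y z w s t : α} (hxy : x ⋖ y) (hyw : y ⋖ w) (hxz : x ⋖ z) (hzw : z ⋖ w)
    (hst : s ⋖ t) {h₀ : ℝ} (hs : (D.pos s).2 ≤ h₀) (ht : h₀ ≤ (D.pos t).2)
    (hx : (D.pos x).2 < h₀) (hw : h₀ < (D.pos w).2)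
    (hl : bend (D.pos x) (D.pos y) (D.pos w) h₀ < lineAt (D.pos s) (D.pos t) h₀)
    (hr : lineAt (D.pos s) (D.pos t) h₀ < bend (D.pos x) (D.pos z) (D.pos w) h₀) :
    D.Inside x y z w t ∨ t = y ∨ t = z ∨ t = w := by
  have hx2 := D.lt_of_covBy _ _ hxy
  have hy2 := D.lt_of_covBy _ _ hyw
  have hxz2 := D.lt_of_covBy _ _ hxz
  have hzw2 := D.lt_of_covBy _ _ hzw
  have hs2 := D.lt_of_covBy _ _ hst
  have h₀₁ : h₀ ≤ min (D.pos t).2 (D.pos w).2 := le_min ht hw.le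
  by_cases hl' : lineAt (D.pos s) (D.pos t) (min (D.pos t).2 (D.pos w).2) ≤
      bend (D.pos x) (D.pos y) (D.pos w) (min (D.pos t).2 (D.pos w).2)
  · have := D.eq_of_crosses hxy hyw hst hs h₀₁ (min_le_left _ _) hx.le (min_le_right _ _)
      (Or.inl ⟨hl, hl'⟩)
    tauto
  by_cases hr' : bend (D.pos x) (D.pos z) (D.pos w) (min (D.pos t).2 (D.pos w).2) ≤
      lineAt (D.pos s) (D.pos t) (min (D.pos t).2 (D.pos w).2)
  · have := D.eq_of_crosses hxz hzw hst hs h₀₁ (min_le_left _ _) hx.le (min_le_right _ _)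
      (Or.inr ⟨hr, hr'⟩)
    tauto
  push Not at hl' hr'
  rcases le_or_gt (D.pos w).2 (D.pos t).2 with hwt | hwt
  · rw [min_eq_right hwt, bend_of_ge hx2 hy2.le, lineAt_right hy2] at hl'
    rw [min_eq_right hwt, bend_of_ge hxz2 hzw2.le, lineAt_right hzw2] at hr'
    linarith
  · rw [min_eq_left hwt.le, lineAt_right hs2] at hl' hr'
    exact Or.inl ⟨hx.trans_le ht, hwt, hl', hr'⟩

variable [Finite α]

theorem height_le {a b : α} (hab : a ≤ b) : (D.pos a).2 ≤ (D.pos b).2 := by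
  induction a using WellFoundedGT.induction with
  | ind a ih =>
    rcases hab.eq_or_lt with rfl | hlt
    · exact le_rfl
    · obtain ⟨c, hac, hcb⟩ := exists_covBy_le_of_lt hlt
      exact (D.lt_of_covBy a c hac).le.trans (ih c hac.lt hcb)

variable [OrderTop α]

theorem le_of_inside {x y z w v : α} (hxy : x ⋖ y) (hyw : y ⋖ w) (hxz : x ⋖ z) (hzw : z ⋖ w)
    (hv : D.Inside x y z w v) : v ≤ w := by
  induction v using WellFoundedGT.induction with
  | ind v ih =>
    rcases eq_or_lt_of_le (le_top : v ≤ ⊤) with rfl | hlt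
    · exact absurd (D.height_le (le_top : w ≤ ⊤)) hv.2.1.not_ge
    · obtain ⟨t, hvt, -⟩ := exists_covBy_le_of_lt hlt
      have h2 := (D.lt_of_covBy v t hvt).le
      rcases D.inside_or_eq hxy hyw hxz hzw hvt le_rfl h2 hv.1 hv.2.1
        (by rw [lineAt_left]; exact hv.2.2.1) (by rw [lineAt_left]; exact hv.2.2.2)
        with h | rfl | rfl | rfl
      · exact hvt.le.trans (ih t hvt.lt h)
      · exact hvt.le.trans hyw.le
      · exact hvt.le.trans hzw.le
      · exact hvt.le

/-- A cover of the bottom of a cell between the left and the right corner is below the top. -/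
theorem le_of_tilt_between {x y z w v : α} (hxy : x ⋖ y) (hyw : y ⋖ w) (hxz : x ⋖ z)
    (hzw : z ⋖ w) (hxv : x ⋖ v) (hl : tilt (D.pos x) (D.pos y) < tilt (D.pos x) (D.pos v))
    (hr : tilt (D.pos x) (D.pos v) < tilt (D.pos x) (D.pos z)) : v ≤ w := by
  have hx2 := D.lt_of_covBy _ _ hxy
  have hy2 := D.lt_of_covBy _ _ hyw
  have hxz2 := D.lt_of_covBy _ _ hxz
  have hxv2 := D.lt_of_covBy _ _ hxv
  set h₀ := min (D.pos v).2 (min (D.pos y).2 (D.pos z).2) with hh₀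
  have hxh : (D.pos x).2 < h₀ := lt_min hxv2 (lt_min hx2 hxz2)
  have hhv : h₀ ≤ (D.pos v).2 := min_le_left _ _
  have hhy : h₀ ≤ (D.pos y).2 := (min_le_right _ _).trans (min_le_left _ _)
  have hhz : h₀ ≤ (D.pos z).2 := (min_le_right _ _).trans (min_le_right _ _)
  rcases D.inside_or_eq hxy hyw hxz hzw hxv hxh.le hhv hxh (hhy.trans_lt hy2)
    (by rw [bend_of_le hhy]; exact lineAt_lt_lineAt hxh hl)
    (by rw [bend_of_le hhz]; exact lineAt_lt_lineAt hxh hr) with h | rfl | rfl | rfl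
  · exact D.le_of_inside hxy hyw hxz hzw h
  · exact hyw.le
  · exact hzw.le
  · exact le_rfl

/-- A cover of the left corner of a cell on the right of the edge to the top is below the top. -/
theorem le_of_tilt_right {x y z w v : α} (hxy : x ⋖ y) (hyw : y ⋖ w) (hxz : x ⋖ z)
    (hzw : z ⋖ w) (hyv : y ⋖ v) (hyz : tilt (D.pos x) (D.pos y) < tilt (D.pos x) (D.pos z))
    (hv : tilt (D.pos y) (D.pos w) < tilt (D.pos y) (D.pos v)) : v ≤ w := by
  have hx2 := D.lt_of_covBy _ _ hxy
  have hy2 := D.lt_of_covBy _ _ hyw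
  have hxz2 := D.lt_of_covBy _ _ hxz
  have hzw2 := D.lt_of_covBy _ _ hzw
  have hyv2 := D.lt_of_covBy _ _ hyv
  -- The left corner is to the left of the right boundary of the cell.
  have hleft : (D.pos y).1 < bend (D.pos x) (D.pos z) (D.pos w) (D.pos y).2 := by
    by_contra! hcon
    have hxh : (D.pos x).2 < min (D.pos y).2 (D.pos z).2 := lt_min hx2 hxz2
    rcases D.eq_of_crosses hxz hzw hxy hxh.le (min_le_left _ _) le_rfl hxh.le hy2.le
      (Or.inr ⟨by rw [bend_of_le (min_le_right _ _)]; exact lineAt_lt_lineAt hxh hyz,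
        by rwa [lineAt_right hx2]⟩) with rfl | rfl
    · exact lt_irrefl _ hyz
    · exact lt_irrefl _ hyw.lt
  have h₀₁ : (D.pos y).2 ≤ min (D.pos v).2 (D.pos w).2 := le_min hyv2.le hy2.le
  by_cases hr : bend (D.pos x) (D.pos z) (D.pos w) (min (D.pos v).2 (D.pos w).2) ≤
      lineAt (D.pos y) (D.pos v) (min (D.pos v).2 (D.pos w).2)
  · rcases D.eq_of_crosses hxz hzw hyv le_rfl h₀₁ (min_le_left _ _) hx2.le (min_le_right _ _)
      (Or.inr ⟨by rwa [lineAt_left], hr⟩) with rfl | rfl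
    · exact hzw.le
    · exact le_rfl
  push Not at hr
  rcases le_or_gt (D.pos w).2 (D.pos v).2 with hwv | hwv
  · rw [min_eq_right hwv, bend_of_ge hxz2 hzw2.le, lineAt_right hzw2] at hr
    have := lineAt_lt_lineAt hy2 hv
    rw [lineAt_right hy2] at this
    linarith
  · rw [min_eq_left hwv.le, lineAt_right hyv2] at hr
    refine D.le_of_inside hxy hyw hxz hzw ⟨hx2.trans hyv2, hwv, ?_, hr⟩
    rw [bend_of_ge hx2 hyv2.le]
    simpa [lineAt_right hyv2] using lineAt_lt_lineAt hyv2 hv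

/-- A cover of the right corner of a cell on the left of the edge to the top is below the top. -/
theorem le_of_tilt_left {x y z w v : α} (hxy : x ⋖ y) (hyw : y ⋖ w) (hxz : x ⋖ z)
    (hzw : z ⋖ w) (hzv : z ⋖ v) (hyz : tilt (D.pos x) (D.pos y) < tilt (D.pos x) (D.pos z))
    (hv : tilt (D.pos z) (D.pos v) < tilt (D.pos z) (D.pos w)) : v ≤ w := by
  refine D.mirror.le_of_tilt_right hxz hzw hxy hyw hzv ?_ ?_ <;>
    rw [tilt_mirror, tilt_mirror] <;> linarith

end PlanarDiagram

/-! ### The two covers of an element -/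

/-- Every element `x ≠ ⊤` has a leftmost cover `left x` and a rightmost cover `right x` and no
other covers, and if they differ, then `x`, `left x`, `right x`, `left x ⊔ right x` form a cell:
no edge leaves `left x` or `right x` into its interior. By convention, `left` and `right` fix
the top element. -/
structure CoverFrame (L : Type*) [Lattice L] [BoundedOrder L] where
  left : L → L
  right : L → L
  left_top : left ⊤ = ⊤
  right_top : right ⊤ = ⊤
  covBy_left : ∀ x, x ≠ ⊤ → x ⋖ left x
  covBy_right : ∀ x, x ≠ ⊤ → x ⋖ right x
  eq_or_eq : ∀ x y, x ⋖ y → y = left x ∨ y = right x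
  right_left : ∀ x, left x ≠ right x → right (left x) = left x ⊔ right x
  left_right : ∀ x, left x ≠ right x → left (right x) = left x ⊔ right x

theorem covBy_sup_of_covBy {L : Type*} [Lattice L] [IsUpperModularLattice L] {x y z : L}
    (hxy : x ⋖ y) (hxz : x ⋖ z) (hne : y ≠ z) : y ⋖ y ⊔ z := by
  have hinf : y ⊓ z = x := by
    refine (hxy.eq_or_eq (le_inf hxy.le hxz.le) inf_le_left).resolve_right fun h => ?_
    exact (hxz.eq_or_eq hxy.le (inf_eq_left.1 h)).elim hxy.lt.ne' hne
  rw [sup_comm]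
  apply IsUpperModularLattice.covBy_sup_of_inf_covBy
  rwa [inf_comm, hinf]

/-- The leftmost and the rightmost covers in a planar diagram of a semimodular lattice without
`M₃` sublattices. A third cover would be between them, hence below their join, and the three
covers would generate an `M₃`. -/
theorem PlanarDiagram.nonempty_coverFrame {L : Type*} [Lattice L] [BoundedOrder L] [Finite L]
    [IsUpperModularLattice L] (D : PlanarDiagram L) (hM : ¬ HasM3Sublattice L) :
    Nonempty (CoverFrame L) := by
  classical
  have hcov : ∀ x : L, x ≠ ⊤ → {y | x ⋖ y}.Nonempty := fun x hx => by
    obtain ⟨y, hy, -⟩ := exists_covBy_le_of_lt (lt_top_iff_ne_top.2 hx)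
    exact ⟨y, hy⟩
  have hmin : ∀ x : L, ∃ y, (x = ⊤ → y = ⊤) ∧ (x ≠ ⊤ → x ⋖ y) ∧
      ∀ z, x ⋖ z → tilt (D.pos x) (D.pos y) ≤ tilt (D.pos x) (D.pos z) := by
    intro x
    by_cases hx : x = ⊤
    · subst hx
      exact ⟨⊤, fun _ => rfl, fun h => absurd rfl h, fun z hz => absurd hz not_top_covBy⟩
    · obtain ⟨y, hy, hmin⟩ := Set.exists_min_image {y | x ⋖ y}
        (fun y => tilt (D.pos x) (D.pos y)) (Set.toFinite _) (hcov x hx)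
      exact ⟨y, fun h => absurd h hx, fun _ => hy, hmin⟩
  have hmax : ∀ x : L, ∃ y, (x = ⊤ → y = ⊤) ∧ (x ≠ ⊤ → x ⋖ y) ∧
      ∀ z, x ⋖ z → tilt (D.pos x) (D.pos z) ≤ tilt (D.pos x) (D.pos y) := by
    intro x
    by_cases hx : x = ⊤
    · subst hx
      exact ⟨⊤, fun _ => rfl, fun h => absurd rfl h, fun z hz => absurd hz not_top_covBy⟩
    · obtain ⟨y, hy, hmax⟩ := Set.exists_max_image {y | x ⋖ y}
        (fun y => tilt (D.pos x) (D.pos y)) (Set.toFinite _) (hcov x hx)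
      exact ⟨y, fun h => absurd h hx, fun _ => hy, hmax⟩
  choose l hlt hlc hl using hmin
  choose r hrt hrc hr using hmax
  -- The cell above `x`.
  have hcell : ∀ x, l x ≠ r x → x ≠ ⊤ ∧ l x ⋖ l x ⊔ r x ∧ r x ⋖ l x ⊔ r x ∧
      tilt (D.pos x) (D.pos (l x)) < tilt (D.pos x) (D.pos (r x)) := by
    intro x hne
    have hx : x ≠ ⊤ := fun h => hne ((hlt x h).trans (hrt x h).symm)
    refine ⟨hx, covBy_sup_of_covBy (hlc x hx) (hrc x hx) hne, ?_, ?_⟩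
    · rw [sup_comm]
      exact covBy_sup_of_covBy (hrc x hx) (hlc x hx) hne.symm
    · exact lt_of_le_of_ne (hl x _ (hrc x hx)) (D.tilt_ne (hlc x hx) (hrc x hx) hne)
  refine ⟨⟨l, r, hlt ⊤ rfl, hrt ⊤ rfl, hlc, hrc, ?_, ?_, ?_⟩⟩
  · intro x y hxy
    by_contra! hcon
    obtain ⟨hyl, hyr⟩ := hcon
    have hx : x ≠ ⊤ := fun h => not_top_covBy (h ▸ hxy)
    have h₁ := lt_of_le_of_ne (hl x y hxy) (D.tilt_ne (hlc x hx) hxy hyl.symm)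
    have h₂ := lt_of_le_of_ne (hr x y hxy) (D.tilt_ne hxy (hrc x hx) hyr)
    have hne : l x ≠ r x := fun h => (h₁.trans h₂).ne (by rw [h])
    obtain ⟨-, hlw, hrw, -⟩ := hcell x hne
    have hyw := D.le_of_tilt_between (hlc x hx) hlw (hrc x hx) hrw hxy h₁ h₂
    have hinf : ∀ a b, x ⋖ a → x ⋖ b → a ≠ b → a ⊓ b = x := fun a b ha hb hab => by
      refine (ha.eq_or_eq (le_inf ha.le hb.le) inf_le_left).resolve_right fun h => ?_
      exact (hb.eq_or_eq ha.le (inf_eq_left.1 h)).elim ha.lt.ne' hab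
    refine hM ⟨x, l x, y, r x, l x ⊔ r x, hyl.symm, hyr, hne, hinf _ _ (hlc x hx) hxy hyl.symm,
      hinf _ _ hxy (hrc x hx) hyr, hinf _ _ (hlc x hx) (hrc x hx) hne, ?_, ?_, rfl⟩
    · exact (hlw.eq_or_eq le_sup_left (sup_le hlw.le hyw)).resolve_left
        (covBy_sup_of_covBy (hlc x hx) hxy hyl.symm).lt.ne'
    · exact (hrw.eq_or_eq le_sup_right (sup_le hyw hrw.le)).resolve_left
        fun h => (covBy_sup_of_covBy (hrc x hx) hxy hyr.symm).lt.ne' (by rw [sup_comm, h])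
  · intro x hne
    obtain ⟨hx, hlw, hrw, hlr⟩ := hcell x hne
    have hlx : l x ≠ ⊤ := fun h => not_top_covBy (h ▸ hlw)
    by_contra hcon
    have hle := D.le_of_tilt_right (hlc x hx) hlw (hrc x hx) hrw (hrc _ hlx) hlr
      (lt_of_le_of_ne (hr _ _ hlw) (D.tilt_ne hlw (hrc _ hlx) (Ne.symm hcon)))
    exact (hlw.eq_or_eq (hrc _ hlx).le hle).elim (hrc _ hlx).lt.ne' hcon
  · intro x hne
    obtain ⟨hx, hlw, hrw, hlr⟩ := hcell x hne
    have hrx : r x ≠ ⊤ := fun h => not_top_covBy (h ▸ hrw)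
    by_contra hcon
    have hle := D.le_of_tilt_left (hlc x hx) hlw (hrc x hx) hrw (hlc _ hrx) hlr
      (lt_of_le_of_ne (hl _ _ hrw) (D.tilt_ne (hlc _ hrx) hrw hcon))
    exact (hrw.eq_or_eq (hlc _ hrx).le hle).elim (hlc _ hrx).lt.ne' hcon

/-! ### Coding a lattice by two linear orders -/

/-- A coding of a lattice `L` by two linear orders on a set `E` of labels, given by injective
positions `r` and `s`. The elements `p e` and `q e` are those whose sets of labels are the initial
segments ending at `e` of the first and of the second order. An element `x` has the label `e` if
`p e ≤ x` or `q e ≤ x`. Joins are unions of sets of labels, the order of `L` is the inclusion of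
sets of labels, and no label belongs to all elements. -/
structure TwoOrderCoding (L E : Type*) [Lattice L] where
  p : E → L
  q : E → L
  r : E → ℕ
  s : E → ℕ
  injective_r : Function.Injective r
  injective_s : Function.Injective s
  label_p : ∀ e f, (p f ≤ p e ∨ q f ≤ p e) ↔ r f ≤ r e
  label_q : ∀ e f, (p f ≤ q e ∨ q f ≤ q e) ↔ s f ≤ s e
  exists_not_label : ∀ e, ∃ x, ¬ (p e ≤ x ∨ q e ≤ x)
  label_sup : ∀ x y e, p e ≤ x ⊔ y ∨ q e ≤ x ⊔ y →
    (p e ≤ x ∨ q e ≤ x) ∨ (p e ≤ y ∨ q e ≤ y)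
  le_of_label : ∀ x y, (∀ e, p e ≤ x ∨ q e ≤ x → p e ≤ y ∨ q e ≤ y) → x ≤ y

theorem WCovBy.sup_left_of_upperModular {L : Type*} [Lattice L]
    [IsUpperModularLattice L] {a b : L} (h : a ⩿ b) (x : L) : x ⊔ a ⩿ x ⊔ b := by
  rcases h.covBy_or_eq with h | rfl
  · rcases h.eq_or_eq (le_inf le_sup_right h.le : a ≤ (x ⊔ a) ⊓ b) inf_le_right with h' | h'
    · have := IsUpperModularLattice.covBy_sup_of_inf_covBy (a := b) (b := x ⊔ a)
        (by rw [inf_comm, h']; exact h)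
      have heq : b ⊔ (x ⊔ a) = x ⊔ b := by
        rw [sup_left_comm, sup_of_le_left h.le]
      rw [heq] at this
      exact this.wcovBy
    · have heq : x ⊔ a = x ⊔ b :=
        le_antisymm (sup_le_sup_left h.le _) (sup_le le_sup_left (inf_eq_right.1 h'))
      rw [heq]
      exact WCovBy.rfl
  · exact WCovBy.rfl

namespace CoverFrame

variable {L : Type*} [Lattice L] [BoundedOrder L] (F : CoverFrame L)

/-- The frame with left and right exchanged. -/
def swap : CoverFrame L where
  left := F.right
  right := F.left
  left_top := F.right_top
  right_top := F.left_top
  covBy_left := F.covBy_right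
  covBy_right := F.covBy_left
  eq_or_eq x y h := (F.eq_or_eq x y h).symm
  right_left x h := by rw [F.left_right x h.symm, sup_comm]
  left_right x h := by rw [F.right_left x h.symm, sup_comm]

/-- The left boundary chain: `F.chain i` is reached from `⊥` by `i` steps to the leftmost cover. -/
def chain (i : ℕ) : L := F.left^[i] ⊥

theorem chain_zero : F.chain 0 = ⊥ := rfl

theorem chain_succ (i : ℕ) : F.chain (i + 1) = F.left (F.chain i) :=
  Function.iterate_succ_apply' _ _ _

theorem chain_wcovBy (i : ℕ) : F.chain i ⩿ F.chain (i + 1) := by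
  rw [chain_succ]
  by_cases h : F.chain i = ⊤
  · rw [h, F.left_top]
    exact WCovBy.rfl
  · exact (F.covBy_left _ h).wcovBy

theorem chain_mono : Monotone F.chain := monotone_nat_of_le_succ fun i => (F.chain_wcovBy i).le

theorem exists_chain_eq_top [Finite L] : ∃ n, F.chain n = ⊤ := by
  by_contra! h
  refine not_injective_infinite_finite F.chain (strictMono_nat_of_lt_succ fun i => ?_).injective
  rw [chain_succ]
  exact (F.covBy_left _ (h i)).lt

theorem exists_chain_le (x : L) (hx : x ≠ ⊤) [Finite L] (i : ℕ) (hi : F.chain i ≤ x) :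
    ∃ j, i ≤ j ∧ F.chain j ≤ x ∧ ¬ F.chain (j + 1) ≤ x := by
  by_contra! h
  have hall : ∀ k, F.chain (i + k) ≤ x := by
    intro k
    induction k with
    | zero => exact hi
    | succ k ih => exact h (i + k) (by omega) ih
  obtain ⟨n, hn⟩ := F.exists_chain_eq_top
  have := (F.chain_mono (show n ≤ i + n by omega)).trans (hall n)
  rw [hn] at this
  exact hx (top_le_iff.1 this)

/-- If `x` is above `F.chain i` but not above `F.chain (i + 1)`, then the leftmost cover of `x` is
`x ⊔ F.chain (i + 1)`: walking up from `F.chain i` to `x`, every step must be to the rightmost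
cover, and each of the cells on the left of the walk transports the leftmost cover. -/
theorem left_eq_sup_chain [Finite L] {x : L} {i : ℕ} (hi : F.chain i ≤ x)
    (hi' : ¬ F.chain (i + 1) ≤ x) : F.left x = x ⊔ F.chain (i + 1) := by
  have key : ∀ y, F.chain i ≤ y → y ≤ x → F.left y = y ⊔ F.chain (i + 1) →
      F.left x = x ⊔ F.chain (i + 1) := by
    intro y
    induction y using WellFoundedGT.induction with
    | ind y ih =>
      intro hiy hyx hy
      rcases hyx.eq_or_lt with rfl | hlt
      · exact hy
      obtain ⟨t, hyt, htx⟩ := exists_covBy_le_of_lt hlt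
      refine ih t hyt.lt (hiy.trans hyt.le) htx ?_
      have hne : t ≠ F.left y := by
        rintro rfl
        exact hi' (le_trans (hy ▸ le_sup_right) htx)
      obtain rfl := (F.eq_or_eq y t hyt).resolve_left hne
      rw [F.left_right y hne.symm, hy, sup_comm, ← sup_assoc, sup_of_le_left hyt.le]
  refine key _ le_rfl hi ?_
  rw [← chain_succ, sup_of_le_right (F.chain_mono (Nat.le_succ i))]

/-- Every element is the join of an element of the left boundary chain and one of the right
boundary chain. -/
theorem exists_eq_sup [Finite L] (x : L) : ∃ i j, x = F.chain i ⊔ F.swap.chain j := by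
  have key : ∀ y, y ≤ x → (∃ i j, y = F.chain i ⊔ F.swap.chain j) →
      ∃ i j, x = F.chain i ⊔ F.swap.chain j := by
    intro y
    induction y using WellFoundedGT.induction with
    | ind y ih =>
      intro hyx hy
      rcases hyx.eq_or_lt with rfl | hlt
      · exact hy
      obtain ⟨t, hyt, htx⟩ := exists_covBy_le_of_lt hlt
      refine ih t hyt.lt htx ?_
      have hytop : y ≠ ⊤ := hlt.ne_top
      obtain ⟨i, j, hij⟩ := hy
      rcases F.eq_or_eq y t hyt with rfl | rfl
      · obtain ⟨k, hik, hk, hk'⟩ := F.exists_chain_le y hytop i (hij ▸ le_sup_left)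
        refine ⟨k + 1, j, ?_⟩
        rw [F.left_eq_sup_chain hk hk']
        apply le_antisymm
        · refine sup_le ?_ le_sup_left
          rw [hij]
          exact sup_le_sup_right (F.chain_mono (by omega)) _
        · exact sup_le le_sup_right (le_sup_of_le_left (hij ▸ le_sup_right))
      · obtain ⟨k, hik, hk, hk'⟩ := F.swap.exists_chain_le y hytop j (hij ▸ le_sup_right)
        refine ⟨i, k + 1, ?_⟩
        have := F.swap.left_eq_sup_chain hk hk'
        change F.right y = _ at this
        rw [this]
        apply le_antisymm
        · refine sup_le ?_ le_sup_right
          rw [hij]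
          exact sup_le_sup_left (F.swap.chain_mono (by omega)) _
        · exact sup_le (le_sup_of_le_left (hij ▸ le_sup_left)) le_sup_right
  exact key ⊥ bot_le ⟨0, 0, by simp [chain_zero]⟩

/-- The element `x` has the label `i` if joining with `x` collapses the `i`-th step of the left
boundary chain. -/
def HasLabel (x : L) (i : ℕ) : Prop := x ⊔ F.chain i = x ⊔ F.chain (i + 1)

variable {F}

theorem HasLabel.mono {x y : L} {i : ℕ} (h : F.HasLabel x i) (hxy : x ≤ y) : F.HasLabel y i := by
  unfold HasLabel at *
  rw [← sup_of_le_left hxy, sup_assoc, h, sup_assoc]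

variable (F)

theorem hasLabel_of_chain_le {x : L} {i : ℕ} (h : F.chain (i + 1) ≤ x) : F.HasLabel x i := by
  unfold HasLabel
  rw [sup_of_le_left h, sup_of_le_left ((F.chain_mono (Nat.le_succ i)).trans h)]

theorem hasLabel_chain_iff {i j : ℕ} (hj : F.chain j ≠ F.chain (j + 1)) :
    F.HasLabel (F.chain i) j ↔ j < i := by
  refine ⟨fun h => ?_, fun h => F.hasLabel_of_chain_le (F.chain_mono h)⟩
  by_contra! hij
  unfold HasLabel at h
  rw [sup_of_le_right (F.chain_mono hij), sup_of_le_right (F.chain_mono (by omega))] at h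
  exact hj h

theorem hasLabel_chain_sup {d : L} {i j : ℕ} (h : F.HasLabel (F.chain i ⊔ d) j) :
    j < i ∨ F.HasLabel d j := by
  by_contra! hcon
  obtain ⟨hij, hd⟩ := hcon
  refine hd ?_
  unfold HasLabel at *
  rwa [sup_right_comm, sup_of_le_right (F.chain_mono hij), sup_right_comm,
    sup_of_le_right (F.chain_mono (show i ≤ j + 1 by omega)), sup_comm, sup_comm _ d] at h

/-- A covering step adds at most one label: if it adds `i`, then it adds no later label `k`. -/
theorem hasLabel_unique [IsUpperModularLattice L] {d d' : L} (hd : d ⩿ d') {i k : ℕ} (hik : i < k)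
    (hi : ¬ F.HasLabel d i) (hi' : F.HasLabel d' i) (hk' : F.HasLabel d' k) :
    F.HasLabel d k := by
  unfold HasLabel at *
  have h₁ : d ⊔ F.chain i < d ⊔ F.chain (i + 1) :=
    lt_of_le_of_ne (sup_le_sup_left (F.chain_mono (Nat.le_succ i)) _) hi
  have h₂ : d ⊔ F.chain (i + 1) ≤ d' ⊔ F.chain i := by
    rw [hi']
    exact sup_le_sup_right hd.le _
  have h₃ : d ⊔ F.chain i ⩿ d' ⊔ F.chain i := by
    rw [sup_comm d, sup_comm d']
    exact hd.sup_left_of_upperModular _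
  have h₄ : d' ≤ d ⊔ F.chain k := by
    rcases h₃.eq_or_eq h₁.le h₂ with h | h
    · exact absurd h h₁.ne'
    · exact (le_sup_left.trans h.ge).trans (sup_le_sup_left (F.chain_mono hik) _)
  refine le_antisymm (sup_le_sup_left (F.chain_mono (Nat.le_succ k)) _) ?_
  calc d ⊔ F.chain (k + 1) ≤ d' ⊔ F.chain (k + 1) := sup_le_sup_right hd.le _
    _ = d' ⊔ F.chain k := hk'.symm
    _ ≤ d ⊔ F.chain k := sup_le h₄ le_sup_right

/-- An element is determined by its labels. -/
theorem le_of_hasLabel [IsUpperModularLattice L] [Finite L] {x y : L} (hxy : x ≤ y)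
    (h : ∀ i, F.HasLabel y i → F.HasLabel x i) : y ≤ x := by
  obtain ⟨n, hn⟩ := F.exists_chain_eq_top
  have key : ∀ k, k ≤ n → x ⊔ F.chain (n - k) = y ⊔ F.chain (n - k) := by
    intro k
    induction k with
    | zero => intro _; simp [hn]
    | succ k ih =>
      intro hk
      have hs : n - (k + 1) + 1 = n - k := by omega
      have ih := ih (by omega)
      rw [← hs] at ih
      have hle : x ⊔ F.chain (n - (k + 1)) ≤ y ⊔ F.chain (n - (k + 1)) := sup_le_sup_right hxy _
      by_cases hl : F.HasLabel x (n - (k + 1))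
      · refine le_antisymm hle ?_
        rw [hl, ih]
        exact sup_le_sup_left (F.chain_mono (Nat.le_succ _)) _
      · have hyl := fun hy => hl (h _ hy)
        have hlt : y ⊔ F.chain (n - (k + 1)) < y ⊔ F.chain (n - (k + 1) + 1) :=
          lt_of_le_of_ne (sup_le_sup_left (F.chain_mono (Nat.le_succ _)) _) hyl
        have hw := (F.chain_wcovBy (n - (k + 1))).sup_left_of_upperModular x
        rw [ih] at hw
        exact ((hw.eq_or_eq hle hlt.le).resolve_right hlt.ne).symm
  have := key n le_rfl
  rw [Nat.sub_self, chain_zero, sup_bot_eq, sup_bot_eq] at this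
  exact this.ge

theorem hasLabel_sup [Finite L] {x y : L} {i : ℕ} (h : F.HasLabel (x ⊔ y) i) :
    F.HasLabel x i ∨ F.HasLabel y i := by
  obtain ⟨a, b, rfl⟩ := F.exists_eq_sup x
  obtain ⟨a', b', rfl⟩ := F.exists_eq_sup y
  rw [sup_sup_sup_comm, ← F.chain_mono.map_sup, ← F.swap.chain_mono.map_sup] at h
  rcases F.hasLabel_chain_sup h with h | h
  · rcases lt_sup_iff.1 h with h | h
    · exact Or.inl (F.hasLabel_of_chain_le (le_sup_of_le_left (F.chain_mono h)))
    · exact Or.inr (F.hasLabel_of_chain_le (le_sup_of_le_left (F.chain_mono h)))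
  · rcases le_total b b' with hb | hb
    · rw [sup_of_le_right hb] at h
      exact Or.inr (h.mono le_sup_right)
    · rw [sup_of_le_left hb] at h
      exact Or.inl (h.mono le_sup_right)

/-- In a finite semimodular lattice in which every element has at most two covers, arranged in
cells, the steps of the left boundary chain are labels. The second linear order is the order in
which the right boundary chain acquires these labels. -/
theorem nonempty_coding [IsUpperModularLattice L] [Finite L] :
    Nonempty (TwoOrderCoding L {i : ℕ // F.chain i ≠ F.chain (i + 1)}) := by
  classical
  have htop : ∀ i, ∃ j, F.HasLabel (F.swap.chain j) i := fun i => by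
    obtain ⟨n, hn⟩ := F.swap.exists_chain_eq_top
    exact ⟨n, by simp [HasLabel, hn]⟩
  have hs : ∀ i j, Nat.find (htop i) ≤ j ↔ F.HasLabel (F.swap.chain j) i := fun i j =>
    ⟨fun h => (Nat.find_spec (htop i)).mono (F.swap.chain_mono h), fun h => Nat.find_min' _ h⟩
  have hlabel : ∀ (x : L) (i : ℕ), (F.chain (i + 1) ≤ x ∨ F.swap.chain (Nat.find (htop i)) ≤ x) ↔
      F.HasLabel x i := by
    intro x i
    constructor
    · rintro (h | h)
      · exact F.hasLabel_of_chain_le h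
      · exact (Nat.find_spec (htop i)).mono h
    · intro h
      obtain ⟨a, b, rfl⟩ := F.exists_eq_sup x
      rcases F.hasLabel_chain_sup h with h | h
      · exact Or.inl (le_sup_of_le_left (F.chain_mono h))
      · exact Or.inr (le_sup_of_le_right (F.swap.chain_mono ((hs _ _).2 h)))
  have hinj : ∀ i k : ℕ, i < k → F.chain i ≠ F.chain (i + 1) → F.chain k ≠ F.chain (k + 1) →
      Nat.find (htop i) ≠ Nat.find (htop k) := by
    intro i k hik hi hk heq
    obtain ⟨m, hm⟩ : ∃ m, Nat.find (htop i) = m + 1 := by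
      refine Nat.exists_eq_succ_of_ne_zero fun h0 => hi ?_
      have := (hs i 0).1 h0.le
      simpa [HasLabel, chain_zero] using this
    have h₁ : ¬ F.HasLabel (F.swap.chain m) i := fun h => by
      have := (hs i m).2 h
      omega
    have h₂ := F.hasLabel_unique (F.swap.chain_wcovBy m) hik h₁ ((hs _ _).1 hm.le)
      ((hs _ _).1 (heq ▸ hm.le))
    have := (hs k m).2 h₂
    omega
  refine ⟨{ p := fun i => F.chain (i + 1), q := fun i => F.swap.chain (Nat.find (htop i)),
            r := fun i => i, s := fun i => Nat.find (htop i),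
            injective_r := Subtype.val_injective, injective_s := ?_, label_p := ?_,
            label_q := ?_, exists_not_label := ?_, label_sup := ?_, le_of_label := ?_ }⟩
  · rintro ⟨i, hi⟩ ⟨k, hk⟩ heq
    rcases lt_trichotomy i k with h | h | h
    · exact absurd heq (hinj i k h hi hk)
    · exact Subtype.ext h
    · exact absurd heq.symm (hinj k i h hk hi)
  · rintro ⟨i, hi⟩ ⟨k, hk⟩
    rw [hlabel, F.hasLabel_chain_iff hk]
    exact Nat.lt_succ_iff
  · rintro ⟨i, hi⟩ ⟨k, hk⟩
    rw [hlabel, ← hs]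
  · rintro ⟨i, hi⟩
    refine ⟨⊥, ?_⟩
    rw [hlabel]
    simpa [HasLabel] using hi
  · rintro x y ⟨i, hi⟩ h
    rw [hlabel] at h
    rw [hlabel, hlabel]
    exact F.hasLabel_sup h
  · intro x y h
    refine le_trans le_sup_right (F.le_of_hasLabel (le_sup_left : y ≤ y ⊔ x) fun i hi => ?_)
    by_cases hne : F.chain i = F.chain (i + 1)
    · unfold HasLabel
      rw [← hne]
    · rcases F.hasLabel_sup hi with hi | hi
      · exact hi
      · exact (hlabel y i).1 (h ⟨i, hne⟩ ((hlabel x i).2 hi))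

end CoverFrame

/-! ### Parents of a label -/

section Parents

variable {E : Type*} {r s : E → ℕ}

/-- Place the label `e` at the point `(r e, s e)` of the plane. `NearestAbove r s e f` says that
`f` is the nearest point on the left of `e` that is higher than `e`. -/
def NearestAbove (r s : E → ℕ) (e f : E) : Prop :=
  r f < r e ∧ s e < s f ∧ ∀ g, r f < r g → r g < r e → s g < s e

/-- There is a point on the left of `e` that is higher than `e`. -/
def HasAbove (r s : E → ℕ) (e : E) : Prop := ∃ g, r g < r e ∧ s e < s g

/-- A label `e` which is neither a left-to-right maximum nor a right-to-left minimum has two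
parents: the nearest higher point on the left, and, with the coordinates exchanged, the nearest
lower point on the right, where the distance is the difference in height. The other labels have
none. -/
def Parent (r s : E → ℕ) (e f : E) : Prop :=
  HasAbove r s e ∧ HasAbove s r e ∧ (NearestAbove r s e f ∨ NearestAbove s r e f)

theorem parent_swap : Parent s r = Parent r s := by
  ext e f
  unfold Parent
  tauto

theorem HasAbove.exists_nearestAbove (hr : Function.Injective r) (hs : Function.Injective s) {e : E}
    (h : HasAbove r s e) : ∃ f, NearestAbove r s e f := by
  have hfin : {g | r g < r e ∧ s e < s g}.Finite :=
    ((Set.finite_lt_nat (r e)).preimage hr.injOn).subset fun g hg => hg.1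
  obtain ⟨f, hf, hmax⟩ := Set.exists_max_image _ r hfin h
  refine ⟨f, hf.1, hf.2, fun g hfg hge => ?_⟩
  by_contra! hcon
  rcases hcon.eq_or_lt with heq | hlt
  · rw [hs heq] at hge
    exact hge.false
  · exact absurd (hmax g ⟨hge, hlt⟩) hfg.not_ge

/-- If `z` were on the left of `e`, it would be a higher point nearer to `e` than `f` is. -/
theorem NearestAbove.lt_of_lt (hr : Function.Injective r) {e f z : E} (h : NearestAbove r s e f)
    (hr' : r f < r z) (hs' : s f < s z) : r e < r z ∧ s e < s z := by
  obtain ⟨h₁, h₂, h₃⟩ := h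
  refine ⟨?_, h₂.trans hs'⟩
  by_contra! hcon
  rcases hcon.eq_or_lt with heq | hlt
  · rw [hr heq] at hs'
    omega
  · have := h₃ z hr' hlt
    omega

/-- If a parent of `e` is in the open quadrant below and to the left of `z`, then so is `e`: if `z`
is higher than `e` and on the left of `e`, then the nearest higher point on the left of `e` is not
on the left of `z`. -/
theorem Parent.lt_of_lt (hr : Function.Injective r) (hs : Function.Injective s) {e f z : E}
    (h : Parent r s e f) (hr' : r f < r z) (hs' : s f < s z) : r e < r z ∧ s e < s z :=
  h.2.2.elim (fun h => h.lt_of_lt hr hr' hs') fun h => (h.lt_of_lt hs hs' hr').symm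

end Parents

/-! ### Congruences and sets of labels -/

namespace TwoOrderCoding

variable {L E : Type*} [Lattice L] (C : TwoOrderCoding L E)

/-- `e` is a label of `x`. -/
def HasLabel (x : L) (e : E) : Prop := C.p e ≤ x ∨ C.q e ≤ x

/-- The coding with the two linear orders exchanged. -/
def swap : TwoOrderCoding L E where
  p := C.q
  q := C.p
  r := C.s
  s := C.r
  injective_r := C.injective_s
  injective_s := C.injective_r
  label_p e f := or_comm.trans (C.label_q e f)
  label_q e f := or_comm.trans (C.label_p e f)
  exists_not_label e := (C.exists_not_label e).imp fun _ h h' => h h'.symm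
  label_sup x y e h := (C.label_sup x y e h.symm).imp Or.symm Or.symm
  le_of_label x y h := C.le_of_label x y fun e he => (h e he.symm).symm

theorem swap_hasLabel {x : L} {e : E} : C.swap.HasLabel x e ↔ C.HasLabel x e := or_comm

variable {C}

theorem HasLabel.mono {x y : L} {e : E} (h : C.HasLabel x e) (hxy : x ≤ y) : C.HasLabel y e :=
  h.imp (fun h => h.trans hxy) fun h => h.trans hxy

variable (C)

theorem hasLabel_sup {x y : L} {e : E} : C.HasLabel (x ⊔ y) e ↔ C.HasLabel x e ∨ C.HasLabel y e :=
  ⟨C.label_sup x y e, fun h => h.elim (fun h => h.mono le_sup_left) fun h => h.mono le_sup_right⟩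

theorem le_iff_hasLabel {x y : L} : x ≤ y ↔ ∀ e, C.HasLabel x e → C.HasLabel y e :=
  ⟨fun h _ he => he.mono h, C.le_of_label x y⟩

theorem hasLabel_p {e f : E} : C.HasLabel (C.p e) f ↔ C.r f ≤ C.r e := C.label_p e f

theorem hasLabel_q {e f : E} : C.HasLabel (C.q e) f ↔ C.s f ≤ C.s e := C.label_q e f

theorem p_le_iff {x : L} {e : E} : C.p e ≤ x ↔ ∀ f, C.r f ≤ C.r e → C.HasLabel x f := by
  simp only [C.le_iff_hasLabel, hasLabel_p]

theorem q_le_iff {x : L} {e : E} : C.q e ≤ x ↔ ∀ f, C.s f ≤ C.s e → C.HasLabel x f := by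
  simp only [C.le_iff_hasLabel, hasLabel_q]

theorem injective_p : Function.Injective C.p := fun e f h =>
  C.injective_r (le_antisymm ((C.label_p f e).1 (Or.inl h.le)) ((C.label_p e f).1 (Or.inl h.ge)))

/-- There is a greatest element without the label `e`, a meet-irreducible element. -/
theorem exists_greatest [Finite L] (e : E) :
    ∃ m, ¬ C.HasLabel m e ∧ ∀ x, ¬ C.HasLabel x e → x ≤ m := by
  obtain ⟨m, hm, hmax⟩ := (Set.toFinite {x | ¬ C.HasLabel x e}).exists_maximal
    (C.exists_not_label e)
  refine ⟨m, hm, fun x hx => ?_⟩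
  have hsup : ¬ C.HasLabel (m ⊔ x) e := fun h => (C.hasLabel_sup.1 h).elim hm hx
  exact le_sup_right.trans (hmax hsup le_sup_left)

theorem exists_step_p {x y : L} (hxy : x ≤ y) (h : ∃ e, ¬ C.HasLabel x e ∧ C.p e ≤ y) :
    ∃ e z, ¬ C.HasLabel x e ∧ C.HasLabel z e ∧ x ≤ z ∧ z ≤ y ∧
      ∀ f, C.HasLabel z f → C.HasLabel x f ∨ f = e := by
  obtain ⟨e, ⟨hxe, hey⟩, hmin⟩ := exists_minimalFor_of_wellFoundedLT _ C.r h
  refine ⟨e, x ⊔ C.p e, hxe, Or.inl le_sup_right, le_sup_left, sup_le hxy hey, fun f hf => ?_⟩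
  by_contra! hcon
  obtain ⟨hxf, hne⟩ := hcon
  have hfe : C.r f ≤ C.r e := C.hasLabel_p.1 ((C.hasLabel_sup.1 hf).resolve_left hxf)
  have hfy : C.p f ≤ y := (C.p_le_iff.2 fun g hg => C.hasLabel_p.2 (hg.trans hfe)).trans hey
  exact hne (C.injective_r (le_antisymm hfe (hmin ⟨hxf, hfy⟩ hfe)))

/-- If `x < y`, then `x` can be enlarged within `y` so as to get precisely one new label. -/
theorem exists_step {x y : L} (hxy : x < y) :
    ∃ e z, ¬ C.HasLabel x e ∧ C.HasLabel z e ∧ x ≤ z ∧ z ≤ y ∧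
      ∀ f, C.HasLabel z f → C.HasLabel x f ∨ f = e := by
  have hnot := hxy.not_ge
  rw [C.le_iff_hasLabel] at hnot
  push Not at hnot
  obtain ⟨e, hye | hye, hxe⟩ := hnot
  · exact C.exists_step_p hxy.le ⟨e, hxe, hye⟩
  · have := C.swap.exists_step_p hxy.le ⟨e, fun h => hxe (C.swap_hasLabel.1 h), hye⟩
    simpa only [swap_hasLabel] using this

/-- The congruence `θ` collapses the label `e`: it identifies two elements only one of which has
the label `e`. -/
def Collapses (θ : LatticeCon L) (e : E) : Prop :=
  ∃ x y, θ.r x y ∧ ¬ C.HasLabel x e ∧ C.HasLabel y e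

variable {C}

/-- A congruence that collapses `e` identifies any `x ≤ y` that differ at most in the label `e`. -/
theorem Collapses.rel_of_le [Finite L] {θ : LatticeCon L} {e : E} (he : C.Collapses θ e) {x y : L}
    (hxy : x ≤ y) (h : ∀ f, C.HasLabel y f → C.HasLabel x f ∨ f = e) : θ.r x y := by
  by_cases hxe : C.HasLabel x e
  · have hyx : y ≤ x := C.le_iff_hasLabel.2 fun f hf =>
      (h f hf).elim id fun h => h ▸ hxe
    rw [le_antisymm hxy hyx]
  obtain ⟨a, b, hab, ha, hb⟩ := he
  -- Both edges are perspective to the edge above the greatest element `m` without the label `e`.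
  obtain ⟨m, hme, hm⟩ := C.exists_greatest e
  have h₁ := θ.inf (θ.sup hab (θ.refl m)) (θ.refl y)
  have h₂ : (a ⊔ m) ⊓ y = x := by
    rw [sup_of_le_right (hm a ha)]
    refine le_antisymm (C.le_iff_hasLabel.2 fun f hf => ?_) (le_inf (hm x hxe) hxy)
    refine (h f (hf.mono inf_le_right)).resolve_right ?_
    rintro rfl
    exact hme (hf.mono inf_le_left)
  have h₃ : (b ⊔ m) ⊓ y = y := by
    refine inf_eq_right.2 (C.le_iff_hasLabel.2 fun f hf => C.hasLabel_sup.2 ?_)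
    rcases h f hf with hf | rfl
    · exact Or.inr (hf.mono (hm x hxe))
    · exact Or.inl hb
  rwa [h₂, h₃] at h₁

variable (C)

theorem rel_of_le [Finite L] {θ : LatticeCon L} {x y : L} (hxy : x ≤ y)
    (h : ∀ e, C.HasLabel y e → C.HasLabel x e ∨ C.Collapses θ e) : θ.r x y := by
  induction x using WellFoundedGT.induction with
  | ind x ih =>
    rcases hxy.eq_or_lt with rfl | hlt
    · exact θ.refl x
    obtain ⟨e, z, hxe, hze, hxz, hzy, hz⟩ := C.exists_step hlt
    have hxz' : x < z := lt_of_le_of_ne hxz fun heq => hxe (heq ▸ hze)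
    have he : C.Collapses θ e := (h e (hze.mono hzy)).resolve_left hxe
    exact θ.trans (he.rel_of_le hxz hz)
      (ih z hxz' hzy fun f hf => (h f hf).imp_left fun hf => hf.mono hxz)

/-- A congruence is determined by the labels it collapses. -/
theorem con_le_iff_collapses [Finite L] {θ θ' : LatticeCon L} :
    θ ≤ θ' ↔ ∀ e, C.Collapses θ e → C.Collapses θ' e := by
  rw [LatticeCon.le_iff]
  constructor
  · rintro h e ⟨x, y, hxy, hx, hy⟩
    exact ⟨x, y, h x y hxy, hx, hy⟩
  · intro h x y hxy
    have key : ∀ x y, θ.r x y → θ'.r x (x ⊔ y) := by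
      intro x y hxy
      refine C.rel_of_le le_sup_left fun e he => ?_
      rcases C.hasLabel_sup.1 he with he | he
      · exact Or.inl he
      · by_cases hx : C.HasLabel x e
        · exact Or.inl hx
        · exact Or.inr (h e ⟨x, y, hxy, hx, he⟩)
    have h₂ := key y x (θ.symm hxy)
    rw [sup_comm] at h₂
    exact θ'.trans (key x y hxy) (θ'.symm h₂)

/-- The edge `m ⋖ m ⊔ p f` with label `f` above the greatest element `m` without the label `f`
yields, by meeting with `p e`, two elements that differ in the label `e`. -/
theorem Collapses.of_nearestAbove [Finite L] {θ : LatticeCon L} {e f : E}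
    (hf : C.Collapses θ f) (hef : NearestAbove C.r C.s e f) (he : HasAbove C.s C.r e) :
    C.Collapses θ e := by
  obtain ⟨hr, hs, hbetween⟩ := hef
  obtain ⟨m, hmf, hm⟩ := C.exists_greatest f
  have hpm : ∀ g, C.r g < C.r f → C.HasLabel m g := fun g hg =>
    Or.inl (hm _ fun h => (C.hasLabel_p.1 h).not_gt hg)
  have hqm : ∀ g, C.s g < C.s f → C.HasLabel m g := fun g hg =>
    Or.inr (hm _ fun h => (C.hasLabel_q.1 h).not_gt hg)
  have hrel : θ.r m (m ⊔ C.p f) := by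
    refine hf.rel_of_le le_sup_left fun g hg => ?_
    rcases C.hasLabel_sup.1 hg with hg | hg
    · exact Or.inl hg
    · rcases (C.hasLabel_p.1 hg).eq_or_lt with hg | hg
      · exact Or.inr (C.injective_r hg)
      · exact Or.inl (hpm g hg)
  have hle : C.p e ≤ m ⊔ C.p f := by
    refine C.p_le_iff.2 fun g hg => C.hasLabel_sup.2 ?_
    rcases le_or_gt (C.r g) (C.r f) with hgf | hgf
    · exact Or.inr (C.hasLabel_p.2 hgf)
    · refine Or.inl (hqm g ?_)
      rcases hg.eq_or_lt with hg | hg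
      · rwa [C.injective_r hg]
      · exact (hbetween g hgf hg).trans hs
  refine ⟨m ⊓ C.p e, (m ⊔ C.p f) ⊓ C.p e, θ.inf hrel (θ.refl _), ?_,
    Or.inl (le_inf hle le_rfl)⟩
  rintro (h | h)
  · exact hmf ((C.hasLabel_p.2 hr.le).mono (h.trans inf_le_left))
  · obtain ⟨g, hg₁, hg₂⟩ := he
    exact absurd (C.hasLabel_p.1 ((C.hasLabel_q.2 hg₁.le).mono (h.trans inf_le_right))) hg₂.not_ge

/-- A congruence that collapses a parent of `e` collapses `e`. -/
theorem Collapses.of_parent [Finite L] {θ : LatticeCon L} {e f : E}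
    (hf : C.Collapses θ f) (hef : Parent C.r C.s e f) : C.Collapses θ e := by
  obtain ⟨h₁, h₂, h | h⟩ := hef
  · exact hf.of_nearestAbove C h h₂
  · have := Collapses.of_nearestAbove C.swap (θ := θ) (e := e) (f := f)
      (by simpa only [Collapses, swap_hasLabel] using hf) h h₁
    simpa only [Collapses, swap_hasLabel] using this

/-- The case of `hasLabel_inf` in which `x ⊓ z` has the label `e` by the first order. If `y` has `e`
only by the second order, then the parent `f` of `e` on the left is still a label of `y ⊓ z`, by
induction on the first coordinate. If `f` is a label of `y ⊓ z` by the first order, then `p e ≤ y`,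
as the points between `f` and `e` are lower than `e`; if by the second order, then `e` is, too. -/
theorem hasLabel_inf_of_p_le {D : Set E} (hD : ∀ e f, Parent C.r C.s e f → f ∈ D → e ∈ D)
    {x y z : L} (hxy : ∀ e ∉ D, C.HasLabel x e → C.HasLabel y e) (n : ℕ) :
    ∀ e ∉ D, C.r e = n → C.p e ≤ x ⊓ z → C.HasLabel (y ⊓ z) e := by
  induction n using Nat.strong_induction_on with
  | _ n ih =>
  intro e heD hn hle
  have hz : C.p e ≤ z := hle.trans inf_le_right
  rcases hxy e heD (Or.inl (hle.trans inf_le_left)) with hy | hy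
  · exact Or.inl (le_inf hy hz)
  by_cases h₁ : HasAbove C.r C.s e
  swap
  · -- The first initial segment ending at `e` is contained in the second.
    refine Or.inl (le_inf (le_trans (C.p_le_iff.2 fun g hg => C.hasLabel_q.2 ?_) hy) hz)
    by_contra! hcon
    refine h₁ ⟨g, lt_of_le_of_ne hg fun heq => ?_, hcon⟩
    rw [C.injective_r heq] at hcon
    exact hcon.false
  by_cases h₂ : HasAbove C.s C.r e
  swap
  · refine Or.inr (le_inf hy (le_trans (C.q_le_iff.2 fun g hg => C.hasLabel_p.2 ?_) hz))
    by_contra! hcon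
    refine h₂ ⟨g, lt_of_le_of_ne hg fun heq => ?_, hcon⟩
    rw [C.injective_s heq] at hcon
    exact hcon.false
  obtain ⟨f, hf⟩ := h₁.exists_nearestAbove C.injective_r C.injective_s
  have hfD : f ∉ D := fun h => heD (hD e f ⟨h₁, h₂, Or.inl hf⟩ h)
  have hfe : C.p f ≤ C.p e := C.p_le_iff.2 fun g hg => C.hasLabel_p.2 (hg.trans hf.1.le)
  rcases ih (C.r f) (hn ▸ hf.1) f hfD rfl (hfe.trans hle) with h | h
  · refine Or.inl (le_inf (C.p_le_iff.2 fun g hg => ?_) hz)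
    rcases le_or_gt (C.r g) (C.r f) with hgf | hgf
    · exact (C.hasLabel_p.2 hgf).mono (h.trans inf_le_left)
    · refine (C.hasLabel_q.2 ?_).mono hy
      rcases hg.eq_or_lt with hg | hg
      · rw [C.injective_r hg]
      · exact (hf.2.2 g hgf hg).le
  · refine Or.inr (le_trans (C.q_le_iff.2 fun g hg => C.hasLabel_q.2 ?_) h)
    exact hg.trans hf.2.1.le

/-- If `D` is closed under descendants, then the labels outside `D` of a meet depend only on the
labels outside `D` of its terms. -/
theorem hasLabel_inf {D : Set E} (hD : ∀ e f, Parent C.r C.s e f → f ∈ D → e ∈ D)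
    {x y z : L} (hxy : ∀ e ∉ D, C.HasLabel x e → C.HasLabel y e) {e : E} (he : e ∉ D)
    (h : C.HasLabel (x ⊓ z) e) : C.HasLabel (y ⊓ z) e := by
  rcases h with h | h
  · exact C.hasLabel_inf_of_p_le hD hxy _ e he rfl h
  · rw [← C.swap_hasLabel]
    refine C.swap.hasLabel_inf_of_p_le
      (fun e f hef => hD e f (parent_swap (r := C.r) (s := C.s) ▸ hef)) ?_ _ e he rfl h
    simpa only [swap_hasLabel] using hxy

/-- The congruence that identifies elements with the same labels outside `D`, for a set `D` of
labels which contains a label if it contains one of its parents. -/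
def ofSet (D : Set E) (hD : ∀ e f, Parent C.r C.s e f → f ∈ D → e ∈ D) : LatticeCon L where
  r x y := ∀ e ∉ D, C.HasLabel x e ↔ C.HasLabel y e
  iseqv := ⟨fun _ _ _ => Iff.rfl, fun h e he => (h e he).symm,
    fun h₁ h₂ e he => (h₁ e he).trans (h₂ e he)⟩
  inf := by
    have key : ∀ {x y z : L}, (∀ e ∉ D, C.HasLabel x e ↔ C.HasLabel y e) →
        ∀ e ∉ D, C.HasLabel (x ⊓ z) e ↔ C.HasLabel (y ⊓ z) e := fun h e he =>
      ⟨C.hasLabel_inf hD (fun e he => (h e he).1) he, C.hasLabel_inf hD (fun e he => (h e he).2) he⟩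
    intro w x y z h₁ h₂ e he
    rw [key h₁ e he, inf_comm, key h₂ e he, inf_comm]
  sup h₁ h₂ e he := by
    rw [C.hasLabel_sup, C.hasLabel_sup, h₁ e he, h₂ e he]

theorem collapses_ofSet [Finite L] {D : Set E}
    {hD : ∀ e f, Parent C.r C.s e f → f ∈ D → e ∈ D} {e : E} :
    C.Collapses (C.ofSet D hD) e ↔ e ∈ D := by
  constructor
  · rintro ⟨x, y, hxy, hx, hy⟩
    by_contra he
    exact hx ((hxy e he).2 hy)
  · intro he
    obtain ⟨m, hme, hm⟩ := C.exists_greatest e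
    refine ⟨m, m ⊔ C.p e, fun f hf => ⟨fun h => h.mono le_sup_left, fun h => ?_⟩, hme,
      Or.inl le_sup_right⟩
    rcases C.hasLabel_sup.1 h with h | h
    · exact h
    · refine Or.inl (hm _ fun h' => hf ?_)
      rwa [C.injective_r (le_antisymm (C.hasLabel_p.1 h) (C.hasLabel_p.1 h'))]

/-- The congruence generated by collapsing the label `e`. -/
def con (e : E) : LatticeCon L :=
  C.ofSet {f | Relation.ReflTransGen (Parent C.r C.s) f e} fun _ _ h h' => h'.head h

theorem collapses_con [Finite L] {e f : E} :
    C.Collapses (C.con e) f ↔ Relation.ReflTransGen (Parent C.r C.s) f e :=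
  C.collapses_ofSet

theorem con_le_iff [Finite L] {e : E} {θ : LatticeCon L} : C.con e ≤ θ ↔ C.Collapses θ e := by
  rw [C.con_le_iff_collapses]
  constructor
  · exact fun h => h e (C.collapses_con.2 .refl)
  · intro h f hf
    rw [collapses_con] at hf
    induction hf using Relation.ReflTransGen.head_induction_on with
    | refl => exact h
    | head h' _ ih => exact ih.of_parent C h'

theorem con_le_con_iff [Finite L] {e f : E} :
    C.con e ≤ C.con f ↔ Relation.ReflTransGen (Parent C.r C.s) e f := by
  rw [con_le_iff, collapses_con]

theorem collapses_sup [Finite L] {θ θ' : LatticeCon L} {e : E} (h : C.Collapses (θ ⊔ θ') e) :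
    C.Collapses θ e ∨ C.Collapses θ' e := by
  have hD : ∀ e f, Parent C.r C.s e f → f ∈ {e | C.Collapses θ e ∨ C.Collapses θ' e} →
      e ∈ {e | C.Collapses θ e ∨ C.Collapses θ' e} := fun e f hef hf =>
    hf.imp (fun h => h.of_parent C hef) fun h => h.of_parent C hef
  have hle : θ ⊔ θ' ≤ C.ofSet _ hD := sup_le
    (C.con_le_iff_collapses.2 fun f hf => C.collapses_ofSet.2 (Or.inl hf))
    (C.con_le_iff_collapses.2 fun f hf => C.collapses_ofSet.2 (Or.inr hf))
  exact C.collapses_ofSet.1 (C.con_le_iff_collapses.1 hle e h)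

theorem supIrred_con [Finite L] (e : E) : SupIrred (C.con e) := by
  constructor
  · intro hmin
    have h := hmin (show C.ofSet ∅ (fun _ _ _ h => h) ≤ C.con e from
      C.con_le_iff_collapses.2 fun f hf => (C.collapses_ofSet.1 hf).elim)
    exact C.collapses_ofSet.1 (C.con_le_iff.1 h)
  · intro θ θ' h
    rcases C.collapses_sup (C.con_le_iff.1 h.ge) with h' | h'
    · exact Or.inl (le_antisymm (h ▸ le_sup_left) (C.con_le_iff.2 h'))
    · exact Or.inr (le_antisymm (h ▸ le_sup_right) (C.con_le_iff.2 h'))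

theorem exists_con_eq [Finite L] {θ : LatticeCon L} (hθ : SupIrred θ) : ∃ e, C.con e = θ := by
  have : Finite E := Finite.of_injective C.p C.injective_p
  have hfin : {e | C.Collapses θ e}.Finite := Set.toFinite _
  obtain ⟨e, -, he⟩ := hθ.finset_sup_eq (s := hfin.toFinset) (f := C.con) <| by
    apply le_antisymm
    · exact Finset.sup_le fun e he => C.con_le_iff.2 (hfin.mem_toFinset.1 he)
    · exact C.con_le_iff_collapses.2 fun e he =>
        C.con_le_iff.1 (Finset.le_sup (f := C.con) (hfin.mem_toFinset.2 he))
  exact ⟨e, he⟩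

end TwoOrderCoding

/-! ### The order generated by the parents, and the crown -/

section Crown

variable {E P : Type*} [PartialOrder P] {r s : E → ℕ} {κ : E → P}

/-- A path of parents from a class to a class covering it contains a step between the two. -/
theorem exists_parent_of_covBy
    (hκ : ∀ e f, κ e ≤ κ f ↔ Relation.ReflTransGen (Parent r s) e f) {e f : E}
    (h : κ e ⋖ κ f) : ∃ e' f', κ e' = κ e ∧ κ f' = κ f ∧ Parent r s e' f' := by
  have hef := (hκ e f).1 h.le
  induction hef using Relation.ReflTransGen.head_induction_on with
  | refl => exact absurd rfl h.lt.ne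
  | @head e g heg hgf ih =>
    rcases h.eq_or_eq ((hκ e g).2 (.single heg)) ((hκ g f).2 hgf) with hg | hg
    · obtain ⟨e', f', h₁, h₂⟩ := ih (hg ▸ h)
      exact ⟨e', f', h₁.trans hg, h₂⟩
    · exact ⟨e, g, rfl, hg, heg⟩

theorem eq_of_le_of_no_parent
    (hκ : ∀ e f, κ e ≤ κ f ↔ Relation.ReflTransGen (Parent r s) e f) {e f : E}
    (he : ∀ g, ¬ Parent r s e g) (h : κ e ≤ κ f) : f = e := by
  rcases Relation.ReflTransGen.cases_head ((hκ e f).1 h) with rfl | ⟨g, hg, -⟩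
  · rfl
  · exact absurd hg (he g)

/-- A maximal class consists of labels without parents: otherwise, the nearest higher point on the
left of a highest point of the class would be in the class. -/
theorem exists_of_isMax [Finite E] (hr : Function.Injective r) (hs : Function.Injective s)
    (hsurj : Function.Surjective κ)
    (hκ : ∀ e f, κ e ≤ κ f ↔ Relation.ReflTransGen (Parent r s) e f) {x : P} (hx : IsMax x) :
    ∃ e, κ e = x ∧ (¬ HasAbove r s e ∨ ¬ HasAbove s r e) := by
  obtain ⟨e, he, hmax⟩ := Set.exists_max_image {e | κ e = x} s (Set.toFinite _) (hsurj x)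
  refine ⟨e, he, ?_⟩
  by_contra! hcon
  obtain ⟨f, hf⟩ := hcon.1.exists_nearestAbove hr hs
  have hle := (hκ e f).2 (.single ⟨hcon.1, hcon.2, Or.inl hf⟩)
  have hfx : κ f = x := by
    rw [show κ e = x from he] at hle
    exact (hx.eq_of_le hle).symm
  exact absurd (hmax f hfx) hf.2.1.not_ge

theorem exists_nearestAbove_of_covBy
    (hκ : ∀ e f, κ e ≤ κ f ↔ Relation.ReflTransGen (Parent r s) e f)
    (hsurj : Function.Surjective κ) {a : E} (ha : ¬ HasAbove r s a) {y : P} (hy : y ⋖ κ a) :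
    ∃ e, κ e = y ∧ NearestAbove r s e a := by
  obtain ⟨e, rfl⟩ := hsurj y
  obtain ⟨e', f, he, hf, hef⟩ := exists_parent_of_covBy hκ hy
  obtain rfl := eq_of_le_of_no_parent hκ (fun g hg => ha hg.1) hf.ge
  refine ⟨e', he, hef.2.2.resolve_right fun h => ha ⟨e', h.2.1, h.1⟩⟩

/-- The open quadrant below and to the left of a point is closed under taking smaller classes. -/
theorem lt_of_le_of_lt_quadrant (hr : Function.Injective r) (hs : Function.Injective s)
    (hκ : ∀ e f, κ e ≤ κ f ↔ Relation.ReflTransGen (Parent r s) e f) {e f z : E}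
    (h : κ e ≤ κ f) (hf : r f < r z ∧ s f < s z) : r e < r z ∧ s e < s z := by
  have h' := (hκ e f).1 h
  clear h
  induction h' using Relation.ReflTransGen.head_induction_on with
  | refl => exact hf
  | head h' _ ih => exact h'.lt_of_lt hr hs ih.1 ih.2

theorem lt_of_not_hasAbove (hs : Function.Injective s) {a c : E} (hc : ¬ HasAbove r s c)
    (h : r a < r c) : s a < s c := by
  by_contra! hcon
  rcases hcon.eq_or_lt with heq | hlt
  · rw [hs heq] at h
    exact h.false
  · exact hc ⟨a, h, hlt⟩

/-- Points whose nearest higher point on the left is `a` are on the left of, and below, any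
left-to-right maximum `c` on the right of `a`. -/
theorem NearestAbove.lt_of_maximum (hr : Function.Injective r) (hs : Function.Injective s)
    {a c e : E} (h : NearestAbove r s e a) (hc : ¬ HasAbove r s c) (hac : r a < r c) :
    r e < r c ∧ s e < s c :=
  h.lt_of_lt hr hac (lt_of_not_hasAbove hs hc hac)

/-- A class is covered by at most one left-to-right maximum. -/
theorem eq_of_covBy_of_covBy (hr : Function.Injective r) (hs : Function.Injective s)
    (hκ : ∀ e f, κ e ≤ κ f ↔ Relation.ReflTransGen (Parent r s) e f)
    (hsurj : Function.Surjective κ) {a b : E} (ha : ¬ HasAbove r s a) (hb : ¬ HasAbove r s b)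
    {y : P} (hya : y ⋖ κ a) (hyb : y ⋖ κ b) : a = b := by
  have key : ∀ a b, ¬ HasAbove r s a → ¬ HasAbove r s b → y ⋖ κ a → y ⋖ κ b → ¬ r a < r b := by
    intro a b ha hb hya hyb hab
    obtain ⟨e, he, hea⟩ := exists_nearestAbove_of_covBy hκ hsurj ha hya
    obtain ⟨f, hf, hfb⟩ := exists_nearestAbove_of_covBy hκ hsurj hb hyb
    have := lt_of_le_of_lt_quadrant hr hs hκ (hf.trans he.symm).le
      (hea.lt_of_maximum hr hs hb hab)
    exact this.1.not_gt hfb.1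
  exact hr (le_antisymm (not_lt.1 (key b a hb ha hyb hya)) (not_lt.1 (key a b ha hb hya hyb)))

/-- If `f`, the parent of `e` on the left, is outside the quadrant of a left-to-right maximum `c`,
then it is not on the left of `c` at all, hence neither is `e`. -/
theorem NearestAbove.not_lt_of_maximum (hs : Function.Injective s) {c e f : E}
    (h : NearestAbove r s e f) (hc : ¬ HasAbove r s c) (hf : ¬ (r f < r c ∧ s f < s c)) :
    ¬ r e < r c := fun he =>
  hf ⟨h.1.trans he, lt_of_not_hasAbove hs hc (h.1.trans he)⟩

/-- Let `a`, `c` be left-to-right maxima and `b`, `d` right-to-left minima, where `a` precedes `c`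
and `b` precedes `d`. If `x` is covered by `a`, `b` and `y` by `c`, `d`, then no element below `x`
is covered by `y`: the points of `x` and of all elements below it are in the quadrants of `c` and
of `d`, those of `y` are in neither, and a point in both quadrants has no parent outside both. -/
theorem false_of_corner (hr : Function.Injective r) (hs : Function.Injective s)
    (hκ : ∀ e f, κ e ≤ κ f ↔ Relation.ReflTransGen (Parent r s) e f)
    (hsurj : Function.Surjective κ) {a b c d : E} (ha : ¬ HasAbove r s a) (hc : ¬ HasAbove r s c)
    (hb : ¬ HasAbove s r b) (hd : ¬ HasAbove s r d) (hac : r a < r c) (hbd : s b < s d)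
    {x y u : P} (hxa : x ⋖ κ a) (hxb : x ⋖ κ b) (hyc : y ⋖ κ c) (hyd : y ⋖ κ d)
    (hux : u ≤ x) (huy : u ⋖ y) : False := by
  have hκ' : ∀ e f, κ e ≤ κ f ↔ Relation.ReflTransGen (Parent s r) e f := by
    rwa [parent_swap]
  obtain ⟨e₁, he₁, h₁⟩ := exists_nearestAbove_of_covBy hκ hsurj ha hxa
  obtain ⟨e₂, he₂, h₂⟩ := exists_nearestAbove_of_covBy hκ' hsurj hb hxb
  obtain ⟨e₃, he₃, h₃⟩ := exists_nearestAbove_of_covBy hκ hsurj hc hyc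
  obtain ⟨e₄, he₄, h₄⟩ := exists_nearestAbove_of_covBy hκ' hsurj hd hyd
  obtain ⟨e, rfl⟩ := hsurj u
  obtain ⟨e', f, he, hf, hef⟩ := exists_parent_of_covBy hκ (he₃ ▸ huy)
  rw [he₃] at hf
  have hfc : ¬ (r f < r c ∧ s f < s c) := fun h =>
    (lt_of_le_of_lt_quadrant hr hs hκ (he₃.trans hf.symm).le h).1.not_gt h₃.1
  have hfd : ¬ (s f < s d ∧ r f < r d) := fun h =>
    (lt_of_le_of_lt_quadrant hs hr hκ' (he₄.trans hf.symm).le h).1.not_gt h₄.1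
  have hec := lt_of_le_of_lt_quadrant hr hs hκ (he.le.trans (hux.trans he₁.ge))
    (h₁.lt_of_maximum hr hs hc hac)
  have hed := lt_of_le_of_lt_quadrant hs hr hκ' (he.le.trans (hux.trans he₂.ge))
    (h₂.lt_of_maximum hs hr hd hbd)
  rcases hef.2.2 with h | h
  · exact h.not_lt_of_maximum hs hc hfc hec.1
  · exact h.not_lt_of_maximum hr hd hfd hed.1

/-- If the maximal elements of the four-crown are alternately left-to-right maxima and
right-to-left minima, then one of the two pendants contradicts `false_of_corner`, depending on the
orders of the opposite maximal elements. -/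
theorem false_of_crown (hr : Function.Injective r) (hs : Function.Injective s)
    (hκ : ∀ e f, κ e ≤ κ f ↔ Relation.ReflTransGen (Parent r s) e f)
    (hsurj : Function.Surjective κ) {a b c d : E} (ha : ¬ HasAbove r s a) (hc : ¬ HasAbove r s c)
    (hb : ¬ HasAbove s r b) (hd : ¬ HasAbove s r d) (hac : a ≠ c) (hbd : b ≠ d)
    {x y z w u v : P} (hxa : x ⋖ κ a) (hxb : x ⋖ κ b) (hyb : y ⋖ κ b) (hyc : y ⋖ κ c)
    (hzc : z ⋖ κ c) (hzd : z ⋖ κ d) (hwd : w ⋖ κ d) (hwa : w ⋖ κ a)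
    (hux : u ⋖ x) (huz : u ⋖ z) (hvy : v ⋖ y) (hvw : v ⋖ w) : False := by
  rcases lt_or_gt_of_ne (hr.ne hac) with h₁ | h₁ <;> rcases lt_or_gt_of_ne (hs.ne hbd) with h₂ | h₂
  · exact false_of_corner hr hs hκ hsurj ha hc hb hd h₁ h₂ hxa hxb hzc hzd hux.le huz
  · exact false_of_corner hr hs hκ hsurj ha hc hd hb h₁ h₂ hwa hwd hyc hyb hvw.le hvy
  · exact false_of_corner hr hs hκ hsurj hc ha hb hd h₁ h₂ hyc hyb hwa hwd hvy.le hvw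
  · exact false_of_corner hr hs hκ hsurj hc ha hd hb h₁ h₂ hzc hzd hxa hxb huz.le hux

theorem not_exists_crown [Finite E] (hr : Function.Injective r) (hs : Function.Injective s)
    (hκ : ∀ e f, κ e ≤ κ f ↔ Relation.ReflTransGen (Parent r s) e f)
    (hsurj : Function.Surjective κ) (g : CrownR → P) (hg : IsCoverPreservingEmbedding g)
    (hmax : ∀ x, IsMax x → IsMax (g x)) : False := by
  have hκ' : ∀ e f, κ e ≤ κ f ↔ Relation.ReflTransGen (Parent s r) e f := by
    rwa [parent_swap]
  have hcov : ∀ x y, CrownR.cov x y = true → g x ⋖ g y := fun x y h =>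
    hg.covBy x y ((CrownR.covBy_iff x y).2 h)
  have hinj : Function.Injective g := fun x y h =>
    le_antisymm ((hg.le_iff_le x y).1 h.le) ((hg.le_iff_le y x).1 h.ge)
  have hrep : ∀ x, IsMax x → ∃ e, κ e = g x ∧ (¬ HasAbove r s e ∨ ¬ HasAbove s r e) :=
    fun x hx => exists_of_isMax hr hs hsurj hκ (hmax x hx)
  obtain ⟨a, ha, ha'⟩ := hrep .a ((CrownR.isMax_iff _).2 (by decide))
  obtain ⟨b, hb, hb'⟩ := hrep .b ((CrownR.isMax_iff _).2 (by decide))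
  obtain ⟨c, hc, hc'⟩ := hrep .c ((CrownR.isMax_iff _).2 (by decide))
  obtain ⟨d, hd, hd'⟩ := hrep .d ((CrownR.isMax_iff _).2 (by decide))
  have hne : ∀ {x y : CrownR} {e f : E}, κ e = g x → κ f = g y → x ≠ y → e ≠ f := by
    rintro x y e f he hf hxy rfl
    exact hxy (hinj (he.symm.trans hf))
  have hpa := ha ▸ hcov .p .a rfl
  have hpb := hb ▸ hcov .p .b rfl
  have hqb := hb ▸ hcov .q .b rfl
  have hqc := hc ▸ hcov .q .c rfl
  have hrc := hc ▸ hcov .r .c rfl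
  have hrd := hd ▸ hcov .r .d rfl
  have hsd := hd ▸ hcov .s .d rfl
  have hsa := ha ▸ hcov .s .a rfl
  have hup := hcov .u .p rfl
  have hur := hcov .u .r rfl
  have hvq := hcov .v .q rfl
  have hvs := hcov .v .s rfl
  have hac : a ≠ c := hne ha hc (by decide)
  have hbd : b ≠ d := hne hb hd (by decide)
  have hab : a ≠ b := hne ha hb (by decide)
  have hbc : b ≠ c := hne hb hc (by decide)
  have hcd : c ≠ d := hne hc hd (by decide)
  -- Neighbouring maximal elements are of different types.
  rcases ha' with ha' | ha'
  · have hb'' := hb'.resolve_left fun h =>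
      hab (eq_of_covBy_of_covBy hr hs hκ hsurj ha' h hpa hpb)
    have hc'' := hc'.resolve_right fun h =>
      hbc (eq_of_covBy_of_covBy hs hr hκ' hsurj hb'' h hqb hqc)
    have hd'' := hd'.resolve_left fun h =>
      hcd (eq_of_covBy_of_covBy hr hs hκ hsurj hc'' h hrc hrd)
    exact false_of_crown hr hs hκ hsurj ha' hc'' hb'' hd'' hac hbd hpa hpb hqb hqc hrc hrd hsd hsa
      hup hur hvq hvs
  · have hb'' := hb'.resolve_right fun h =>
      hab (eq_of_covBy_of_covBy hs hr hκ' hsurj ha' h hpa hpb)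
    have hc'' := hc'.resolve_left fun h =>
      hbc (eq_of_covBy_of_covBy hr hs hκ hsurj hb'' h hqb hqc)
    have hd'' := hd'.resolve_right fun h =>
      hcd (eq_of_covBy_of_covBy hs hr hκ' hsurj hc'' h hrc hrd)
    exact false_of_crown hs hr hκ' hsurj ha' hc'' hb'' hd'' hac hbd hpa hpb hqb hqc hrc hrd hsd hsa
      hup hur hvq hvs

end Crown

theorem mainTheorem2 {L : Type*} [Lattice L] (hL : IsSPSLattice L) (hcard : 3 ≤ Nat.card L) :
    ¬ ∃ f : CrownR → JiCon L,
      IsCoverPreservingEmbedding f ∧ ∀ x : CrownR, IsMax x → IsMax (f x) := by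
  rintro ⟨g, hg, hmax⟩
  have := hL.finite
  have := hL.semimodular
  have : Nonempty L := (Nat.card_pos_iff.1 (by omega)).1
  have := Fintype.ofFinite L
  let _ : BoundedOrder L := Fintype.toBoundedOrder L
  obtain ⟨D⟩ := hL.planar
  obtain ⟨F⟩ := D.nonempty_coverFrame hL.slim
  obtain ⟨C⟩ := F.nonempty_coding
  have := Finite.of_injective C.p C.injective_p
  refine not_exists_crown (κ := fun e => (⟨C.con e, C.supIrred_con e⟩ : JiCon L)) C.injective_r
    C.injective_s (fun e f => C.con_le_con_iff) ?_ g hg hmax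
  rintro ⟨θ, hθ⟩
  obtain ⟨e, he⟩ := C.exists_con_eq hθ
  exact ⟨e, Subtype.ext he⟩
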